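/- Let $n \ge 0$ be an integer and let $C$ be a nonempty set. Let $B^+_{n,C}$ be the monoid of positive $C$-coloured braids, that is, the monoid presented by the generators $\sigma_i^a$ (where $a$ is a superscript label, not an exponent) for $i \in \{1, \dots, n\}$ and $a \in C$, subject to the relations $$\sigma_i^a \sigma_j^b = \sigma_j^b \sigma_i^a \quad \text{for } |i-j| \ge 2 \text{ and } a, b \in C,$$ $$\sigma_i^a \sigma_j^b \sigma_i^c = \sigma_j^c \sigma_i^b \sigma_j^a \quad \text{for } |i-j| = 1 \text{ and } a, b, c \in C.$$ Then $B^+_{n,C}$ is left cancellative and right cancellative: for all $x, y, z \in B^+_{n,C}$, $xy = xz$ implies $y = z$, and $yx = zx$ implies $y = z$. -/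

import Mathlib

/-- The generator `σ_i^a`, as a one-letter word. The positions `1, …, n` are represented by
`Fin n` (shifted by one; the relations depend only on differences of positions). -/
def colSigma {n : ℕ} {C : Type*} (i : Fin n) (a : C) : FreeMonoid (Fin n × C) :=
  FreeMonoid.of (i, a)

/-- The defining relations of the monoid of positive `C`-coloured braids. -/
inductive ColBraidRel (n : ℕ) (C : Type*) :
    FreeMonoid (Fin n × C) → FreeMonoid (Fin n × C) → Prop
  | comm (i j : Fin n) (a b : C) (h : 2 ≤ |((i : ℕ) : ℤ) - ((j : ℕ) : ℤ)|) :
      ColBraidRel n C (colSigma i a * colSigma j b) (colSigma j b * colSigma i a)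
  | braid (i j : Fin n) (a b c : C) (h : |((i : ℕ) : ℤ) - ((j : ℕ) : ℤ)| = 1) :
      ColBraidRel n C (colSigma i a * colSigma j b * colSigma i c)
        (colSigma j c * colSigma i b * colSigma j a)

/-- The monoid `B⁺_{n,C}` of positive `C`-coloured braids, with generators `σ_i^a` for
`1 ≤ i ≤ n` and `a ∈ C`. -/
abbrev ColBraidMonoid (n : ℕ) (C : Type*) : Type _ :=
  PresentedMonoid (ColBraidRel n C)

/-!
# Cancellativity of the monoid of positive coloured braids

The proof describes completely when two products `σ_i^a X` and `σ_j^d Y` agree: the equality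
must come from a single defining relation (`DivRel`). The description is established by induction
on the length of words, and cancellativity is the special case of equal first letters.
-/

namespace ColBraid

variable {n : ℕ} {C : Type*}

/-! This is Garside's argument for braid monoids. Two words are equal when a chain of relations
links them, so the point is that `DivRel` composes along the chain (`DivBelow.trans`). The middle
tail `V` then has two factorisations, and being shorter than the products at hand it falls under the
induction hypothesis. Only three positions are involved, and in each configuration commutation and
braid moves close the diagram with matching colours. Right cancellation follows from left
cancellation by reversal, which respects the relations. -/

/-- Two positions at distance one. -/
def Adj (i j : Fin n) : Prop := (i : ℕ) + 1 = j ∨ (j : ℕ) + 1 = i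

/-- Two positions at distance at least two. -/
def Far (i j : Fin n) : Prop := (i : ℕ) + 2 ≤ j ∨ (j : ℕ) + 2 ≤ i

theorem Adj.symm {i j : Fin n} (h : Adj i j) : Adj j i := Or.symm h

theorem Far.symm {i j : Fin n} (h : Far i j) : Far j i := Or.symm h

theorem adj_of_abs {i j : Fin n} (h : |((i : ℕ) : ℤ) - ((j : ℕ) : ℤ)| = 1) : Adj i j := by
  unfold Adj
  rcases (abs_eq zero_le_one).1 h with h | h <;> omega

theorem far_of_abs {i j : Fin n} (h : 2 ≤ |((i : ℕ) : ℤ) - ((j : ℕ) : ℤ)|) : Far i j := by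
  unfold Far
  rcases le_abs.1 h with h | h <;> omega

theorem eq_or_far_or_adj (i j : Fin n) : i = j ∨ Far i j ∨ Adj i j := by
  unfold Far Adj
  rw [Fin.ext_iff]
  omega

/-- The generator `σ_i^a` of the monoid of positive coloured braids. -/
def gen (i : Fin n) (a : C) : ColBraidMonoid n C :=
  PresentedMonoid.mk (ColBraidRel n C) (colSigma i a)

/-- The trailing factor `x` lets the relation rewrite inside right-nested products. -/
theorem gen_comm {i j : Fin n} (h : Far i j) (a b : C) (x : ColBraidMonoid n C) :
    gen i a * (gen j b * x) = gen j b * (gen i a * x) := by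
  have h' : 2 ≤ |((i : ℕ) : ℤ) - ((j : ℕ) : ℤ)| := by
    unfold Far at h
    rw [le_abs]
    omega
  have key : gen i a * gen j b = gen j b * gen i a :=
    Quotient.sound (ConGen.Rel.of _ _ (ColBraidRel.comm i j a b h'))
  rw [← mul_assoc, key, mul_assoc]

theorem gen_braid {i j : Fin n} (h : Adj i j) (a b c : C) (x : ColBraidMonoid n C) :
    gen i a * (gen j b * (gen i c * x)) = gen j c * (gen i b * (gen j a * x)) := by
  have h' : |((i : ℕ) : ℤ) - ((j : ℕ) : ℤ)| = 1 := by
    unfold Adj at h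
    rw [abs_eq zero_le_one]
    omega
  have key : gen i a * gen j b * gen i c = gen j c * gen i b * gen j a :=
    Quotient.sound (ConGen.Rel.of _ _ (ColBraidRel.braid i j a b c h'))
  simpa only [mul_assoc] using congrArg (· * x) key

/-- The length homomorphism, with values in the multiplicative copy of `ℕ`. -/
def lenHom (n : ℕ) (C : Type*) : ColBraidMonoid n C →* Multiplicative ℕ :=
  PresentedMonoid.lift (fun _ => Multiplicative.ofAdd 1) (by
    rintro _ _ (_ | _) <;> simp [colSigma])

/-- The length of a positive coloured braid. -/
def len (x : ColBraidMonoid n C) : ℕ := (lenHom n C x).toAdd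

theorem len_gen_mul (i : Fin n) (a : C) (x : ColBraidMonoid n C) :
    len (gen i a * x) = len x + 1 := by
  have h : lenHom n C (gen i a) = Multiplicative.ofAdd 1 :=
    PresentedMonoid.lift_of _ _
  simp [len, h, add_comm]

theorem len_mul (x y : ColBraidMonoid n C) : len (x * y) = len x + len y := by
  simp [len]

/-! ### Composing front relations -/

/-- `DivRel i a j d X Y` says that the equality `σ_i^a X = σ_j^d Y` follows from one application
of a defining relation at the front. -/
def DivRel (i : Fin n) (a : C) (j : Fin n) (d : C) (X Y : ColBraidMonoid n C) : Prop :=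
  (i = j ∧ a = d ∧ X = Y) ∨
  (Far i j ∧ ∃ Z, X = gen j d * Z ∧ Y = gen i a * Z) ∨
  (Adj i j ∧ ∃ b Z, X = gen j b * (gen i d * Z) ∧ Y = gen i b * (gen j a * Z))

theorem DivRel.symm {i j : Fin n} {a d : C} {X Y : ColBraidMonoid n C}
    (h : DivRel i a j d X Y) : DivRel j d i a Y X := by
  rcases h with ⟨rfl, rfl, rfl⟩ | ⟨h, Z, hX, hY⟩ | ⟨h, b, Z, hX, hY⟩
  · exact .inl ⟨rfl, rfl, rfl⟩
  · exact .inr (.inl ⟨h.symm, Z, hY, hX⟩)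
  · exact .inr (.inr ⟨h.symm, b, Z, hY, hX⟩)

theorem DivRel.mul_right {i j : Fin n} {a d : C} {X Y : ColBraidMonoid n C}
    (h : DivRel i a j d X Y) (W : ColBraidMonoid n C) : DivRel i a j d (X * W) (Y * W) := by
  rcases h with ⟨rfl, rfl, rfl⟩ | ⟨h, Z, rfl, rfl⟩ | ⟨h, b, Z, rfl, rfl⟩
  · exact .inl ⟨rfl, rfl, rfl⟩
  · exact .inr (.inl ⟨h, Z * W, by simp only [mul_assoc], by simp only [mul_assoc]⟩)
  · exact .inr (.inr ⟨h, b, Z * W, by simp only [mul_assoc], by simp only [mul_assoc]⟩)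

/-- Equalities `σ_i^a X = σ_j^d Y` with `X` of length less than `L` come from single relations. -/
def DivBelow (n : ℕ) (C : Type*) (L : ℕ) : Prop :=
  ∀ (i j : Fin n) (a d : C) (X Y : ColBraidMonoid n C), len X < L →
    gen i a * X = gen j d * Y → DivRel i a j d X Y

namespace DivBelow

variable {L : ℕ} {i j k : Fin n} {a d e : C} {X Y V : ColBraidMonoid n C}

theorem eq (H : DivBelow n C L) (hL : len X < L) (h : gen i a * X = gen i d * Y) :
    a = d ∧ X = Y := by
  rcases H _ _ _ _ _ _ hL h with ⟨-, h⟩ | ⟨h, -⟩ | ⟨h, -⟩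
  · exact h
  · unfold Far at h; omega
  · unfold Adj at h; omega

theorem far (H : DivBelow n C L) (hij : Far i j) (hL : len X < L)
    (h : gen i a * X = gen j d * Y) : ∃ Z, X = gen j d * Z ∧ Y = gen i a * Z := by
  rcases H _ _ _ _ _ _ hL h with ⟨rfl, -⟩ | ⟨-, h⟩ | ⟨h, -⟩
  · unfold Far at hij; omega
  · exact h
  · unfold Far at hij; unfold Adj at h; omega

theorem adj (H : DivBelow n C L) (hij : Adj i j) (hL : len X < L)
    (h : gen i a * X = gen j d * Y) :
    ∃ b Z, X = gen j b * (gen i d * Z) ∧ Y = gen i b * (gen j a * Z) := by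
  rcases H _ _ _ _ _ _ hL h with ⟨rfl, -⟩ | ⟨h, -⟩ | ⟨-, h⟩
  · unfold Adj at hij; omega
  · unfold Adj at hij; unfold Far at h; omega
  · exact h

theorem trans_far_far (H : DivBelow n C L) (hik : Far i k) (hkj : Far k j) (hV : len V ≤ L)
    {Z Z' : ColBraidMonoid n C} (hX : X = gen k e * Z') (hV₁ : V = gen i a * Z')
    (hV₂ : V = gen j d * Z) (hY : Y = gen k e * Z) : DivRel i a j d X Y := by
  subst hX hY
  have h := hV₁.symm.trans hV₂
  have hl : len Z' < L := by rw [hV₁, len_gen_mul] at hV; omega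
  rcases H _ _ _ _ _ _ hl h with ⟨rfl, rfl, rfl⟩ | ⟨hij, U, rfl, rfl⟩ | ⟨hij, b, U, rfl, rfl⟩
  · exact .inl ⟨rfl, rfl, rfl⟩
  · exact .inr (.inl ⟨hij, gen k e * U, gen_comm hkj _ _ _, gen_comm hik.symm _ _ _⟩)
  · refine .inr (.inr ⟨hij, b, gen k e * U, ?_, ?_⟩)
    · rw [gen_comm hkj, gen_comm hik.symm]
    · rw [gen_comm hik.symm, gen_comm hkj]

/-- If `i` and `j` are adjacent, the positions form a path with `j` in the middle. -/
theorem trans_far_adj (H : DivBelow n C L) (hik : Far i k) (hkj : Adj k j) (hV : len V ≤ L)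
    {Z Z' : ColBraidMonoid n C} {b : C} (hX : X = gen k e * Z') (hV₁ : V = gen i a * Z')
    (hV₂ : V = gen j b * (gen k d * Z)) (hY : Y = gen k b * (gen j e * Z)) :
    DivRel i a j d X Y := by
  subst hX hY
  have h := hV₁.symm.trans hV₂
  have hl : len Z' < L := by rw [hV₁, len_gen_mul] at hV; omega
  have hl' : len Z + 1 < L := by rw [hV₂, len_gen_mul, len_gen_mul] at hV; omega
  rcases eq_or_far_or_adj i j with rfl | hij | hij
  · unfold Far at hik; unfold Adj at hkj; omega
  · obtain ⟨U, rfl, hU⟩ := H.far hij hl h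
    obtain ⟨T, rfl, rfl⟩ := H.far hik.symm (by omega) hU
    refine .inr (.inl ⟨hij, gen k b * (gen j e * T), ?_, ?_⟩)
    · rw [gen_braid hkj]
    · rw [gen_comm hij.symm, gen_comm hik.symm]
  · obtain ⟨c, U, rfl, hU⟩ := H.adj hij hl h
    obtain ⟨T, rfl, hT⟩ := H.far hik.symm (by omega) hU
    have hl₂ : len U < L := by simp only [len_gen_mul] at hl; omega
    -- The new colour `f` becomes the middle colour of the braid relation between `i` and `j`.
    obtain ⟨f, S, rfl, rfl⟩ := H.adj hkj.symm hl₂ hT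
    refine .inr (.inr ⟨hij, f, gen k c * (gen j b * (gen i e * S)), ?_, ?_⟩)
    · rw [gen_comm hik, gen_braid hkj, gen_braid hij.symm e b d, gen_comm hik.symm]
    · rw [gen_braid hij.symm e c f, gen_comm hik.symm, gen_comm hik e a S,
        gen_braid hkj b c a]

theorem trans_adj_adj (H : DivBelow n C L) (hik : Adj i k) (hkj : Adj k j) (hV : len V ≤ L)
    {Z Z' : ColBraidMonoid n C} {b b' : C} (hX : X = gen k b * (gen i e * Z'))
    (hV₁ : V = gen i b * (gen k a * Z')) (hV₂ : V = gen j b' * (gen k d * Z))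
    (hY : Y = gen k b' * (gen j e * Z)) : DivRel i a j d X Y := by
  subst hX hY
  have h := hV₁.symm.trans hV₂
  have hl : len Z' + 1 < L := by rw [hV₁, len_gen_mul, len_gen_mul] at hV; omega
  have hl' : len Z + 1 < L := by rw [hV₂, len_gen_mul, len_gen_mul] at hV; omega
  have hl₁ : len (gen k a * Z') < L := by rwa [len_gen_mul]
  rcases eq_or_far_or_adj i j with rfl | hij | hij
  · obtain ⟨rfl, h'⟩ := H.eq hl₁ h
    obtain ⟨rfl, rfl⟩ := H.eq (by omega) h'
    exact .inl ⟨rfl, rfl, rfl⟩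
  · obtain ⟨U, hU', hU⟩ := H.far hij hl₁ h
    obtain ⟨c, S, rfl, rfl⟩ := H.adj hkj (by omega) hU'
    obtain ⟨f, T, rfl, hT⟩ := H.adj hik.symm (by omega) hU
    simp only [len_gen_mul] at hl hl'
    -- Both expressions for `U` begin at position `k`, which forces `c = f`.
    obtain ⟨rfl, hST⟩ := H.eq (by rw [len_gen_mul]; omega) hT
    obtain ⟨R, rfl, rfl⟩ := H.far hij.symm (by omega) hST
    refine .inr (.inl ⟨hij, gen k c * (gen j b * (gen i b' * (gen k e * R))), ?_, ?_⟩)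
    · rw [gen_comm hij e c, gen_braid hik e b' d, gen_braid hkj b c d]
    · rw [gen_comm hij.symm e c, gen_braid hkj.symm e b a, gen_braid hik.symm b' c a,
        gen_comm hij b' b]
  -- Three positions on a line cannot be pairwise adjacent.
  · unfold Adj at hik hkj hij; omega

theorem trans (H : DivBelow n C L) (hV : len V ≤ L) (h₁ : DivRel i a k e X V)
    (h₂ : DivRel k e j d V Y) : DivRel i a j d X Y := by
  rcases h₁ with ⟨rfl, rfl, rfl⟩ | ⟨hik, Z', hX, hV₁⟩ | ⟨hik, b, Z', hX, hV₁⟩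
  · exact h₂
  · rcases h₂ with ⟨rfl, rfl, rfl⟩ | ⟨hkj, Z, hV₂, hY⟩ | ⟨hkj, b, Z, hV₂, hY⟩
    · exact .inr (.inl ⟨hik, Z', hX, hV₁⟩)
    · exact H.trans_far_far hik hkj hV hX hV₁ hV₂ hY
    · exact H.trans_far_adj hik hkj hV hX hV₁ hV₂ hY
  · rcases h₂ with ⟨rfl, rfl, rfl⟩ | ⟨hkj, Z, hV₂, hY⟩ | ⟨hkj, b', Z, hV₂, hY⟩
    · exact .inr (.inr ⟨hik, b, Z', hX, hV₁⟩)
    -- The same configuration read from `Y` to `X`.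
    · exact (H.trans_far_adj hkj.symm hik.symm hV hY hV₂ hV₁ hX).symm
    · exact H.trans_adj_adj hik hkj hV hX hV₁ hV₂ hY

end DivBelow

/-! ### From words to the monoid -/

/-- The class of a word. -/
abbrev cls (u : FreeMonoid (Fin n × C)) : ColBraidMonoid n C :=
  PresentedMonoid.mk (ColBraidRel n C) u

theorem cls_mul (u v : FreeMonoid (Fin n × C)) : cls (u * v) = cls u * cls v := rfl

theorem cls_of_mul (i : Fin n) (a : C) (u : FreeMonoid (Fin n × C)) :
    cls (FreeMonoid.of (i, a) * u) = gen i a * cls u := rfl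

/-- Two words are both empty, or their first letters and tails are related by `DivRel`. -/
def WordRel (u v : FreeMonoid (Fin n × C)) : Prop :=
  (u = 1 ∧ v = 1) ∨ ∃ i a u' j d v', u = FreeMonoid.of (i, a) * u' ∧
    v = FreeMonoid.of (j, d) * v' ∧ DivRel i a j d (cls u') (cls v')

theorem wordRel_refl (u : FreeMonoid (Fin n × C)) : WordRel u u := by
  induction u using FreeMonoid.casesOn with
  | one => exact .inl ⟨rfl, rfl⟩
  | of_mul x u => exact .inr ⟨x.1, x.2, u, x.1, x.2, u, rfl, rfl, .inl ⟨rfl, rfl, rfl⟩⟩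

theorem wordRel_of_colBraidRel {u v : FreeMonoid (Fin n × C)} (h : ColBraidRel n C u v) :
    WordRel u v := by
  rcases h with ⟨i, j, a, b, h⟩ | ⟨i, j, a, b, c, h⟩
  · exact .inr ⟨i, a, colSigma j b, j, b, colSigma i a, rfl, rfl,
      .inr (.inl ⟨far_of_abs h, 1, (mul_one _).symm, (mul_one _).symm⟩)⟩
  · refine .inr ⟨i, a, colSigma j b * colSigma i c, j, c, colSigma i b * colSigma j a,
      mul_assoc _ _ _, mul_assoc _ _ _, .inr (.inr ⟨adj_of_abs h, b, 1, ?_, ?_⟩)⟩ <;>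
    rw [mul_one] <;> rfl

/-- An empty first factor passes the claim to the second; otherwise the second only lengthens the
tails, where just its class matters, whence `hc`. -/
theorem WordRel.mul {u v u₁ v₁ : FreeMonoid (Fin n × C)} (h : WordRel u v)
    (h₁ : WordRel u₁ v₁) (hc : cls u₁ = cls v₁) : WordRel (u * u₁) (v * v₁) := by
  rcases h with ⟨rfl, rfl⟩ | ⟨i, a, u', j, d, v', rfl, rfl, h⟩
  · simpa using h₁
  · refine .inr ⟨i, a, u' * u₁, j, d, v' * v₁, mul_assoc _ _ _, mul_assoc _ _ _, ?_⟩
    have := h.mul_right (cls u₁)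
    rw [cls_mul, cls_mul, ← hc]
    exact this

/-- Relations preserve length, so intermediate words have length at most `L + 1` and their tails at
most `L`, as `DivBelow.trans` requires. -/
theorem wordRel_of_conGen {L : ℕ} (H : DivBelow n C L) {u v : FreeMonoid (Fin n × C)}
    (h : ConGen.Rel (ColBraidRel n C) u v) (hL : len (cls u) ≤ L + 1) : WordRel u v := by
  induction h with
  | of u v h => exact wordRel_of_colBraidRel h
  | refl u => exact wordRel_refl u
  | @symm u v h ih =>
    have hc : cls u = cls v := Quotient.sound h
    rcases ih (hc ▸ hL) with ⟨hu, hv⟩ | ⟨i, a, u', j, d, v', hu, hv, h⟩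
    · exact .inl ⟨hv, hu⟩
    · exact .inr ⟨j, d, v', i, a, u', hv, hu, h.symm⟩
  | @trans u v w h₁ h₂ ih₁ ih₂ =>
    have hc : cls u = cls v := Quotient.sound h₁
    rcases ih₁ hL with ⟨rfl, rfl⟩ | ⟨i, a, u', k, e, v', rfl, rfl, hd⟩
    · exact ih₂ hL
    · rcases ih₂ (hc ▸ hL) with ⟨hv, -⟩ | ⟨k', e', v'', j, d, w', hv, rfl, hd'⟩
      · simp at hv
      · obtain ⟨hke, rfl⟩ := List.cons.inj hv
        obtain ⟨rfl, rfl⟩ := Prod.mk.inj hke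
        refine .inr ⟨i, a, u', j, d, w', rfl, rfl, H.trans ?_ hd hd'⟩
        rw [hc, cls_of_mul, len_gen_mul] at hL
        omega
  | @mul u v u₁ v₁ h h₁ ih ih₁ =>
    rw [cls_mul, len_mul] at hL
    exact (ih (by omega)).mul (ih₁ (by omega)) (Quotient.sound h₁)

theorem divBelow (n : ℕ) (C : Type*) (L : ℕ) : DivBelow n C L := by
  induction L with
  | zero => intro i j a d X Y h; omega
  | succ L H =>
    intro i j a d X Y hL h
    induction X using PresentedMonoid.inductionOn with | _ u
    induction Y using PresentedMonoid.inductionOn with | _ v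
    have hr : ConGen.Rel (ColBraidRel n C) (FreeMonoid.of (i, a) * u)
      (FreeMonoid.of (j, d) * v) := Quotient.exact h
    rcases wordRel_of_conGen H hr (by rw [cls_of_mul, len_gen_mul]; exact hL) with
      ⟨hu, -⟩ | ⟨i', a', u', j', d', v', hu, hv, hd⟩
    · simp at hu
    · obtain ⟨hia, rfl⟩ := List.cons.inj hu
      obtain ⟨hjd, rfl⟩ := List.cons.inj hv
      obtain ⟨rfl, rfl⟩ := Prod.mk.inj hia
      obtain ⟨rfl, rfl⟩ := Prod.mk.inj hjd
      exact hd

/-! ### Cancellation on both sides -/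

theorem gen_mul_left_cancel {i : Fin n} {a : C} {X Y : ColBraidMonoid n C}
    (h : gen i a * X = gen i a * Y) : X = Y :=
  ((divBelow n C (len X + 1)).eq (Nat.lt_succ_self _) h).2

@[elab_as_elim]
theorem gen_induction {P : ColBraidMonoid n C → Prop} (x : ColBraidMonoid n C) (one : P 1)
    (gen_mul : ∀ i a y, P y → P (gen i a * y)) : P x := by
  induction x using PresentedMonoid.inductionOn with | _ u
  induction u using FreeMonoid.recOn with
  | one => exact one
  | of_mul p u ih => exact gen_mul p.1 p.2 _ ih

theorem left_cancel (x : ColBraidMonoid n C) {y z : ColBraidMonoid n C}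
    (h : x * y = x * z) : y = z := by
  induction x using gen_induction with
  | one => simpa using h
  | gen_mul i a x ih =>
    rw [mul_assoc, mul_assoc] at h
    exact ih (gen_mul_left_cancel h)

/-- Reading a coloured braid backwards. -/
def rev (n : ℕ) (C : Type*) : ColBraidMonoid n C →* (ColBraidMonoid n C)ᵐᵒᵖ :=
  PresentedMonoid.lift (fun p => MulOpposite.op (gen p.1 p.2)) (by
    rintro _ _ (⟨i, j, a, b, h⟩ | ⟨i, j, a, b, c, h⟩)
    · have := gen_comm (far_of_abs h).symm b a 1
      simp only [mul_one] at this
      simp [colSigma, ← MulOpposite.op_mul, this]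
    · have := gen_braid (adj_of_abs h) c b a 1
      simp only [mul_one] at this
      simp [colSigma, ← MulOpposite.op_mul, this])

theorem rev_gen (i : Fin n) (a : C) : rev n C (gen i a) = MulOpposite.op (gen i a) :=
  PresentedMonoid.lift_of _ _

theorem rev_rev (x : ColBraidMonoid n C) : (rev n C (rev n C x).unop).unop = x := by
  induction x using gen_induction with
  | one => simp
  | gen_mul i a x ih =>
    rw [map_mul, MulOpposite.unop_mul, map_mul, MulOpposite.unop_mul, ih, rev_gen,
      MulOpposite.unop_op, rev_gen, MulOpposite.unop_op]

theorem right_cancel (x : ColBraidMonoid n C) {y z : ColBraidMonoid n C}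
    (h : y * x = z * x) : y = z := by
  have h' := congrArg (fun w => (rev n C w).unop) h
  simp only [map_mul, MulOpposite.unop_mul] at h'
  rw [← rev_rev y, left_cancel _ h', rev_rev]

end ColBraid

theorem mainTheorem2 (n : ℕ) (C : Type*) [Nonempty C] :
    IsLeftCancelMul (ColBraidMonoid n C) ∧ IsRightCancelMul (ColBraidMonoid n C) :=
  ⟨⟨fun x _ _ h => ColBraid.left_cancel x h⟩, ⟨fun x _ _ h => ColBraid.right_cancel x h⟩⟩
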